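/- All Hilbert spaces are finite-dimensional and nonzero. A \emph{channel} (memory) $\mathcal N:A\to B$ is a completely positive trace-preserving linear map from the operators on $\mathcal H_A$ to the operators on $\mathcal H_B$; $\mathcal I_d$ is the identity channel on a $d$-dimensional system (ideal $d$-dimensional memory). A channel is \emph{entanglement breaking} (EB) if it has the form $\rho\mapsto\sum_i \mathrm{Tr}[\rho M_i]\,\sigma_i$ for a finite POVM $\{M_i\}$ and density operators $\sigma_i$. A \emph{superchannel} is a map $\Lambda(\mathcal C)=\mathcal V\circ(\mathcal C\otimes \mathrm{id}_E)\circ\mathcal U$ with channels $\mathcal U,\mathcal V$ and a finite-dimensional ancilla $E$; it is \emph{free} (resource non-generating) if it maps every EB channel to an EB channel. $\|\cdot\|_\diamond$ is the diamond norm, $\|\Phi\|_\diamond=\sup_k\sup_{\|X\|_1\le 1}\|(\Phi\otimes\mathrm{id}_k)(X)\|_1$. For a channel $\mathcal N$ put $$\mathcal R(\mathcal N)=\min\Big\{s\ge 0:\ \exists\,\mathcal M\in\mathrm{EB},\ \tfrac{\mathcal N+s\mathcal M}{1+s}\in\mathrm{EB}\Big\},\qquad \mathrm{LR}(\mathcal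 N)=\log_2(1+\mathcal R(\mathcal N)),$$ $$\mathcal R^\varepsilon(\mathcal N)=\min_{\|\mathcal N'-\mathcal N\|_\diamond\le\varepsilon}\mathcal R(\mathcal N'),\qquad \mathrm{LR}^\varepsilon(\mathcal N)=\min_{\|\mathcal N'-\mathcal N\|_\diamond\le\varepsilon}\mathrm{LR}(\mathcal N'),$$ where $\mathcal N'$ ranges over channels with the same input and output systems as $\mathcal N$. \textbf{Theorem.} Let $\mathcal N$ be a channel and $0\le\varepsilon<1$. The minima defining $\mathcal R(\mathcal N)$, $\mathcal R^\varepsilon(\mathcal N)$ and $\mathrm{LR}^\varepsilon(\mathcal N)$ are attained, and: (1) the least $d\geq 1$ for which there is a free superchannel $\Lambda$ with $\|\Lambda(\mathcal I_d)-\mathcal N\|_\diamond\le\varepsilon$ exists and equals $$R^\varepsilon_{\mathrm{syn}}(\mathcal N)=1+\lceil\mathcal R^\varepsilon(\mathcal N)\rceil;$$ (2) for the single-shot dilution rate $R_c^{1,\varepsilon}(\mathcal N)$, the minimum of $\log_2 d$ over the same $d$ (which is attained), $$R_c^{1,\varepsilon}(\mathcal N)=\log_2\big(1+\lceil\mathcal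 R^\varepsilon(\mathcal N)\rceil\big),\qquad \mathrm{LR}^\varepsilon(\mathcal N)\le R_c^{1,\varepsilon}(\mathcal N)\le \mathrm{LR}^\varepsilon(\mathcal N)+1;$$ (3) the least $n\ge 0$ for which there is a free superchannel $\Lambda$ with $\Lambda(\mathcal I_2^{\otimes n})=\mathcal N$ exists and equals $\big\lceil\log_2(\lceil\mathcal R(\mathcal N)\rceil+1)\big\rceil$. -/

import Mathlib

open scoped MatrixOrder ComplexOrder

noncomputable section

namespace QMemory

/-- Linear super-operators from the operators on `ℂ^A` to the operators on `ℂ^B`, where `A` and `B`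
are finite sets that label orthonormal bases. -/
abbrev Op (A B : Type*) := Matrix A A ℂ →ₗ[ℂ] Matrix B B ℂ

/-- `ampl E Φ` is `Φ ⊗ id_E`, which acts as `Φ` on the first tensor factor and trivially on an
ancilla with basis `E`. -/
def ampl {A B : Type*} (E : Type*) (Φ : Op A B) : Op (A × E) (B × E) where
  toFun X := Matrix.of fun p q => Φ (Matrix.of fun a a' => X (a, p.2) (a', q.2)) p.1 q.1
  map_add' X Y := by
    ext p q
    exact congrFun (congrFun (Φ.map_add (Matrix.of fun a a' => X (a, p.2) (a', q.2))
      (Matrix.of fun a a' => Y (a, p.2) (a', q.2))) p.1) q.1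
  map_smul' c X := by
    ext p q
    exact congrFun (congrFun (Φ.map_smul c (Matrix.of fun a a' => X (a, p.2) (a', q.2))) p.1) q.1

/-- Complete positivity. -/
def IsCP {A B : Type*} (Φ : Op A B) : Prop :=
  ∀ (k : ℕ) (X : Matrix (A × Fin k) (A × Fin k) ℂ),
    X.PosSemidef → (ampl (Fin k) Φ X).PosSemidef

/-- Preservation of the trace. -/
def IsTP {A B : Type*} [Fintype A] [Fintype B] (Φ : Op A B) : Prop :=
  ∀ X : Matrix A A ℂ, (Φ X).trace = X.trace

/-- Quantum channels (memories): completely positive trace-preserving maps. -/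
def IsChannel {A B : Type*} [Fintype A] [Fintype B] (Φ : Op A B) : Prop :=
  IsCP Φ ∧ IsTP Φ

/-- Entanglement-breaking channels, in measure-and-prepare form:
`Φ(ρ) = ∑ i, Tr[ρ Mᵢ] σᵢ` for a POVM `(Mᵢ)` and density operators `σᵢ`. -/
def IsEB {A B : Type*} [Fintype A] [DecidableEq A] [Fintype B] (Φ : Op A B) : Prop :=
  ∃ (n : ℕ) (M : Fin n → Matrix A A ℂ) (σ : Fin n → Matrix B B ℂ),
    (∀ i, (M i).PosSemidef) ∧ ∑ i, M i = 1 ∧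
    (∀ i, (σ i).PosSemidef ∧ (σ i).trace = 1) ∧
    ∀ ρ : Matrix A A ℂ, Φ ρ = ∑ i, (ρ * M i).trace • σ i

/-- The trace norm `Tr √(X† X)`. -/
def traceNorm {A : Type*} [Fintype A] [DecidableEq A] (X : Matrix A A ℂ) : ℝ :=
  (CFC.sqrt (X.conjTranspose * X)).trace.re

/-- The diamond norm `sup_k sup {‖(Φ ⊗ id_k)(X)‖₁ : ‖X‖₁ ≤ 1}`, as an extended nonnegative real. -/
def diamondNorm {A B : Type*} [Fintype A] [DecidableEq A] [Fintype B] [DecidableEq B]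
    (Φ : Op A B) : ENNReal :=
  ⨆ (k : ℕ) (X : Matrix (A × Fin k) (A × Fin k) ℂ) (_ : traceNorm X ≤ 1),
    ENNReal.ofReal (traceNorm (ampl (Fin k) Φ X))

/-- The ideal `d`-dimensional memory: the identity channel on a `d`-dimensional system. -/
def idealMemory (d : ℕ) : Op (Fin d) (Fin d) := LinearMap.id

/-- The tensor power `Φ^{⊗ n}`, with `Fin n → A` labelling the product basis of `(ℂ^A)^{⊗ n}`. -/
def tensorPow {A B : Type*} [Fintype A] [DecidableEq A] (n : ℕ) (Φ : Op A B) :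
    Op (Fin n → A) (Fin n → B) where
  toFun X := Matrix.of fun b b' =>
    ∑ a : Fin n → A, ∑ a' : Fin n → A,
      X a a' * ∏ i, Φ (Matrix.single (a i) (a' i) 1) (b i) (b' i)
  map_add' X Y := by
    ext b b'
    simp [add_mul, Finset.sum_add_distrib]
  map_smul' c X := by
    ext b b'
    simp [mul_assoc, Finset.mul_sum]

/-- Superchannels, the physical transformations of channels `A → B` into channels `A' → B'`: a
pre-processing channel, the input channel next to an idle ancilla `E`, a post-processing channel. -/
def IsSuperchannel {A B A' B' : Type*} [Fintype A] [Fintype B] [Fintype A'] [Fintype B']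
    (Λ : Op A B → Op A' B') : Prop :=
  ∃ (E : Type) (_ : Fintype E) (U : Op A' (A × E)) (V : Op (B × E) B'),
    IsChannel U ∧ IsChannel V ∧ ∀ Φ : Op A B, Λ Φ = V ∘ₗ ampl E Φ ∘ₗ U

/-- Free (resource non-generating) transformations: superchannels that map every
entanglement-breaking channel to an entanglement-breaking channel. -/
def IsFree {A B A' B' : Type*} [Fintype A] [DecidableEq A] [Fintype B]
    [Fintype A'] [DecidableEq A'] [Fintype B'] (Λ : Op A B → Op A' B') : Prop :=
  IsSuperchannel Λ ∧ ∀ M : Op A B, IsEB M → IsEB (Λ M)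

section Measures

variable {A B : Type*} [Fintype A] [DecidableEq A] [Fintype B] [DecidableEq B]

/-- The `s ≥ 0` such that `(N + s M) / (1 + s)` is entanglement breaking for some
entanglement-breaking `M`. -/
def robustnessSet (N : Op A B) : Set ℝ :=
  {s | 0 ≤ s ∧ ∃ M : Op A B, IsEB M ∧ IsEB ((1 + s)⁻¹ • (N + s • M))}

/-- The robustness of quantum memory `R(N)`. -/
def robustness (N : Op A B) : ℝ := sInf (robustnessSet N)

/-- The channels in the closed diamond-norm ball of radius `ε` around `N`. -/
def channelBall (ε : ℝ) (N : Op A B) : Set (Op A B) :=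
  {N' | IsChannel N' ∧ diamondNorm (N' - N) ≤ ENNReal.ofReal ε}

/-- The smoothed robustness `R^ε(N)`. -/
def smoothRobustness (ε : ℝ) (N : Op A B) : ℝ :=
  sInf (robustness '' channelBall ε N)

/-- The logarithmic robustness `LR(N) = log₂ (1 + R(N))`. -/
def logRobustness (N : Op A B) : ℝ := Real.logb 2 (1 + robustness N)

/-- The smoothed logarithmic robustness `LR^ε(N)`. -/
def smoothLogRobustness (ε : ℝ) (N : Op A B) : ℝ :=
  sInf (logRobustness '' channelBall ε N)

/-- The dimensions `d` of ideal memories that some free transformation turns into a channel that is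
`ε`-close to `N` in diamond norm. -/
def synthesisDims (ε : ℝ) (N : Op A B) : Set ℕ :=
  {d | 0 < d ∧ ∃ Λ : Op (Fin d) (Fin d) → Op A B,
    IsFree Λ ∧ diamondNorm (Λ (idealMemory d) - N) ≤ ENNReal.ofReal ε}

/-- The single-shot dilution rate: the least `log₂ d` over the dimensions `d` above. -/
def dilutionRate (ε : ℝ) (N : Op A B) : ℝ :=
  sInf ((fun d : ℕ => Real.logb 2 (d : ℝ)) '' synthesisDims ε N)

/-- The numbers `n` of ideal qubit memories such that some free transformation turns
`I₂^{⊗ n}` exactly into `N`. -/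
def qubitCounts (N : Op A B) : Set ℕ :=
  {n | ∃ Λ : Op (Fin n → Fin 2) (Fin n → Fin 2) → Op A B,
    IsFree Λ ∧ Λ (tensorPow n (idealMemory 2)) = N}

end Measures

end QMemory

end

open scoped Kronecker

noncomputable section

namespace QMemory

variable {A B C D P E : Type*}

/-! ### Completely positive maps and their building blocks -/

section CompletePositivity

/-! Everything reduces to one equivalence, `exists_isFree_iff`: a free superchannel turns the
identity on `ℂ^D` into exactly `N` if and only if `R(N) ≤ |D| - 1`.

Necessity. A superchannel is real-linear, so a free one carries a decomposition `N + s M = (1 + s)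
M'` with `M`, `M'` EB to another of the same kind, and robustness cannot grow
(`IsFree.robustnessSet_subset`). The identity itself admits `s = |D| - 1`: measuring in, and
preparing, random-phase vectors gives an EB map whose multiple by `|D|` is the identity plus an EB
map of weight `|D| - 1` (`card_sub_one_mem_robustnessSet_id`).

Sufficiency. Given `N + (d - 1) M = d M'`, test the memory with a maximally entangled pair, then
apply `N` on success and `M` on failure. A memory of entanglement fidelity `F` becomes `F N + (1 -
F) M`. The identity has `F = 1` and yields `N`; an EB memory has `F ≤ 1/d` and yields `F d M' + (1 -
F d) M`, a mixture of EB channels (`exists_isFree_eq`).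

Minimizing over the diamond ball and rounding up to an integer gives the rates. The minima exist
because the EB channels form a compact set (`isCompact_isEB`) and the ball is closed. -/

theorem ampl_add (Φ Ψ : Op A B) : ampl E (Φ + Ψ) = ampl E Φ + ampl E Ψ := rfl

theorem ampl_zero : ampl E (0 : Op A B) = 0 := rfl

theorem ampl_id : ampl E (LinearMap.id : Op A A) = LinearMap.id := rfl

theorem IsCP.comp {Ψ : Op B C} {Φ : Op A B} (hΨ : IsCP Ψ) (hΦ : IsCP Φ) : IsCP (Ψ ∘ₗ Φ) :=
  fun k X hX => hΨ k _ (hΦ k X hX)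

theorem IsCP.add {Φ Ψ : Op A B} (hΦ : IsCP Φ) (hΨ : IsCP Ψ) : IsCP (Φ + Ψ) :=
  fun k X hX => by rw [ampl_add]; exact (hΦ k X hX).add (hΨ k X hX)

theorem IsCP.zero : IsCP (0 : Op A B) :=
  fun k X _ => by rw [ampl_zero]; exact Matrix.PosSemidef.zero

theorem IsCP.sum {ι : Type*} (s : Finset ι) {Φ : ι → Op A B} (h : ∀ i ∈ s, IsCP (Φ i)) :
    IsCP (∑ i ∈ s, Φ i) := by
  classical
  induction s using Finset.induction_on with
  | empty => simpa using IsCP.zero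
  | insert i s hi ih =>
    rw [Finset.sum_insert hi]
    exact (h i (by simp)).add (ih fun j hj => h j (by simp [hj]))

theorem IsCP.posSemidef_ampl [Fintype E] {Φ : Op A B} (h : IsCP Φ)
    {X : Matrix (A × E) (A × E) ℂ} (hX : X.PosSemidef) : (ampl E Φ X).PosSemidef := by
  let e := Fintype.equivFin E
  have h1 := (h _ _ (hX.submatrix (Prod.map id e.symm))).submatrix (Prod.map id e)
  convert h1 using 1
  ext p q
  simp [ampl]

theorem IsCP.posSemidef {Φ : Op A B} (h : IsCP Φ) {X : Matrix A A ℂ} (hX : X.PosSemidef) :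
    (Φ X).PosSemidef := by
  have h1 := (h.posSemidef_ampl (E := Unit) (hX.submatrix Prod.fst)).submatrix fun b => (b, ())
  exact h1

theorem IsCP.ampl [Fintype E] {Φ : Op A B} (h : IsCP Φ) : IsCP (ampl E Φ) := by
  intro k X hX
  have h1 := h.posSemidef_ampl (hX.submatrix fun p : A × (E × Fin k) => ((p.1, p.2.1), p.2.2))
  exact h1.submatrix fun p : (B × E) × Fin k => (p.1.1, (p.1.2, p.2))

/-- The partial trace against an operator `Q` on the first tensor factor. -/
def sliceMap [Fintype P] (Q : Matrix P P ℂ) : Op (P × C) C where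
  toFun X := Matrix.of fun c c' => ∑ p, ∑ q, Q q p * X (p, c) (q, c')
  map_add' X Y := by
    ext c c'
    simp [mul_add, Finset.sum_add_distrib]
  map_smul' t X := by
    ext c c'
    simp only [Matrix.smul_apply, Matrix.of_apply, RingHom.id_apply, smul_eq_mul, Finset.mul_sum]
    exact Finset.sum_congr rfl fun p _ => Finset.sum_congr rfl fun q _ => by ring

/-- Attaching a system in the state `σ`. -/
def attachMap (σ : Matrix P P ℂ) : Op C (P × C) where
  toFun X := σ ⊗ₖ X
  map_add' _ _ := Matrix.kronecker_add ..
  map_smul' _ _ := Matrix.kronecker_smul ..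

theorem sliceMap_apply [Fintype P] (Q : Matrix P P ℂ) (X : Matrix (P × C) (P × C) ℂ) (c c' : C) :
    sliceMap Q X c c' = ∑ p, ∑ q, Q q p * X (p, c) (q, c') := rfl

theorem attachMap_apply (σ : Matrix P P ℂ) (X : Matrix C C ℂ) (p q : P × C) :
    attachMap σ X p q = σ p.1 q.1 * X p.2 q.2 := rfl

/-- Relabelling of the basis. -/
def reindexMap (f : D → C) : Op C D where
  toFun X := X.submatrix f f
  map_add' _ _ := rfl
  map_smul' _ _ := rfl

theorem reindexMap_apply (f : D → C) (X : Matrix C C ℂ) (p q : D) :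
    reindexMap f X p q = X (f p) (f q) := rfl

theorem ampl_apply (Φ : Op A B) (X : Matrix (A × E) (A × E) ℂ) (p q : B × E) :
    ampl E Φ X p q = Φ (Matrix.of fun a a' => X (a, p.2) (a', q.2)) p.1 q.1 := rfl

/-- Slicing is a Hadamard product with the transpose of `Q`, spread over the other factors, followed
by a congruence by the 0-1 matrix `K` that sums out `P`. Positivity is then the Schur product
theorem. -/
theorem isCP_sliceMap [Fintype P] [Fintype C] {Q : Matrix P P ℂ} (hQ : Q.PosSemidef) :
    IsCP (sliceMap (C := C) Q) := by
  classical
  intro k X hX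
  have h1 : (Q.transpose.submatrix (fun p : (P × C) × Fin k => p.1.1) fun p => p.1.1).PosSemidef :=
    hQ.transpose.submatrix _
  let K : Matrix ((P × C) × Fin k) (C × Fin k) ℂ :=
    Matrix.of fun p r => if p.1.2 = r.1 ∧ p.2 = r.2 then 1 else 0
  have h2 : ampl (Fin k) (sliceMap Q) X = K.conjTranspose *
      (Q.transpose.submatrix (fun p : (P × C) × Fin k => p.1.1) fun p => p.1.1).hadamard X * K := ?_
  · rw [h2]
    exact (h1.hadamard hX).conjTranspose_mul_mul_same K
  ext r r'
  simp only [K, ampl_apply, sliceMap_apply, Matrix.of_apply, Matrix.mul_apply,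
    Matrix.conjTranspose_apply, Fintype.sum_prod_type, Matrix.hadamard_apply,
    Matrix.submatrix_apply, Matrix.transpose_apply, ite_and]
  simp only [apply_ite (star : ℂ → ℂ), star_one, star_zero, ite_mul, one_mul, zero_mul, mul_ite,
    mul_one, mul_zero, Finset.sum_ite_irrel, Finset.sum_const_zero,
    Finset.sum_ite_eq', Finset.mem_univ, if_true]
  exact Finset.sum_comm

theorem isCP_attachMap [Fintype P] [Fintype C] {σ : Matrix P P ℂ} (hσ : σ.PosSemidef) :
    IsCP (attachMap (C := C) σ) := by
  intro k X hX
  exact (hσ.kronecker hX).submatrix fun p : (P × C) × Fin k => (p.1.1, (p.1.2, p.2))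

theorem isCP_reindexMap (f : D → C) : IsCP (reindexMap f) :=
  fun k X hX => hX.submatrix (Prod.map f id)

end CompletePositivity

/-! ### Trace preservation and channels -/

section Trace

variable [Fintype A] [Fintype B] [Fintype C] [Fintype D]

theorem IsTP.comp {Ψ : Op B C} {Φ : Op A B} (hΨ : IsTP Ψ) (hΦ : IsTP Φ) : IsTP (Ψ ∘ₗ Φ) :=
  fun X => (hΨ _).trans (hΦ X)

theorem IsTP.ampl [Fintype E] {Φ : Op A B} (h : IsTP Φ) : IsTP (ampl E Φ) := by
  intro X
  have h1 := fun e => h (Matrix.of fun a a' => X (a, e) (a', e))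
  simp only [Matrix.trace, Matrix.diag, QMemory.ampl, LinearMap.coe_mk, AddHom.coe_mk,
    Matrix.of_apply, Fintype.sum_prod_type_right] at h1 ⊢
  exact Finset.sum_congr rfl fun e _ => h1 e

theorem isTP_attachMap [Fintype P] {σ : Matrix P P ℂ} (hσ : σ.trace = 1) :
    IsTP (attachMap (C := C) σ) := fun X => by
  simp [attachMap, Matrix.trace_kronecker, hσ]

theorem isTP_reindexMap (f : D ≃ C) : IsTP (reindexMap f) := fun X =>
  Equiv.sum_comp f fun c => X c c

theorem IsChannel.comp {Ψ : Op B C} {Φ : Op A B} (hΨ : IsChannel Ψ) (hΦ : IsChannel Φ) :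
    IsChannel (Ψ ∘ₗ Φ) := ⟨hΨ.1.comp hΦ.1, hΨ.2.comp hΦ.2⟩

theorem IsChannel.ampl [Fintype E] {Φ : Op A B} (h : IsChannel Φ) : IsChannel (ampl E Φ) :=
  ⟨h.1.ampl, h.2.ampl⟩

theorem isChannel_id : IsChannel (LinearMap.id : Op A A) :=
  ⟨fun _ _ hX => hX, fun _ => rfl⟩

end Trace

/-! ### Measure-and-prepare maps and entanglement breaking -/

section MeasurePrepare

/-- The elementary measure-and-prepare map `ρ ↦ Tr[ρ M] σ`. -/
def measurePrepare [Fintype A] (M : Matrix A A ℂ) (σ : Matrix B B ℂ) : Op A B where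
  toFun ρ := (ρ * M).trace • σ
  map_add' X Y := by rw [add_mul, Matrix.trace_add, add_smul]
  map_smul' t X := by simp [mul_smul]

theorem measurePrepare_apply [Fintype A] (M : Matrix A A ℂ) (σ : Matrix B B ℂ)
    (ρ : Matrix A A ℂ) : measurePrepare M σ ρ = (ρ * M).trace • σ := rfl

/-- Density operators. -/
def IsDensity [Fintype B] (σ : Matrix B B ℂ) : Prop := σ.PosSemidef ∧ σ.trace = 1

variable [Fintype A] [Fintype B] [Fintype C]

/-- Attach `σ`, swap the two factors, then trace out the input against `M`. -/
theorem isCP_measurePrepare {M : Matrix A A ℂ} {σ : Matrix B B ℂ} (hM : M.PosSemidef)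
    (hσ : σ.PosSemidef) : IsCP (measurePrepare M σ) := by
  have h := ((isCP_sliceMap (C := B) hM).comp (isCP_reindexMap Prod.swap)).comp
    (isCP_attachMap (C := A) hσ)
  convert h using 1
  ext ρ b b'
  simp only [measurePrepare_apply, sliceMap_apply, reindexMap_apply, attachMap_apply,
    LinearMap.comp_apply, Prod.swap, Matrix.smul_apply, Matrix.trace, Matrix.diag, Matrix.mul_apply,
    smul_eq_mul, Finset.sum_mul]
  exact Finset.sum_congr rfl fun p _ => Finset.sum_congr rfl fun q _ => by ring

/-- Finite sums of elementary measure-and-prepare maps, without normalization of the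
measurement. -/
def IsMP (Φ : Op A B) : Prop :=
  ∃ (n : ℕ) (M : Fin n → Matrix A A ℂ) (σ : Fin n → Matrix B B ℂ),
    (∀ i, (M i).PosSemidef) ∧ (∀ i, IsDensity (σ i)) ∧ Φ = ∑ i, measurePrepare (M i) (σ i)

theorem IsMP.of_fintype {ι : Type*} [Fintype ι] {M : ι → Matrix A A ℂ} {σ : ι → Matrix B B ℂ}
    (hM : ∀ i, (M i).PosSemidef) (hσ : ∀ i, IsDensity (σ i)) :
    IsMP (∑ i, measurePrepare (M i) (σ i)) := by
  let e := (Fintype.equivFin ι).symm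
  exact ⟨_, M ∘ e, σ ∘ e, fun i => hM _, fun i => hσ _,
    (Equiv.sum_comp e fun i => measurePrepare (M i) (σ i)).symm⟩

theorem IsMP.add {Φ Ψ : Op A B} (hΦ : IsMP Φ) (hΨ : IsMP Ψ) : IsMP (Φ + Ψ) := by
  obtain ⟨n, M, σ, hM, hσ, rfl⟩ := hΦ
  obtain ⟨m, M', σ', hM', hσ', rfl⟩ := hΨ
  have h := IsMP.of_fintype (ι := Fin n ⊕ Fin m) (M := Sum.elim M M') (σ := Sum.elim σ σ')
    (by rintro (i | i) <;> simp [hM, hM']) (by rintro (i | i) <;> simp [hσ, hσ'])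
  simpa [Fintype.sum_sum_type] using h

omit [Fintype B] in
theorem measurePrepare_smul (t : ℝ) (M : Matrix A A ℂ) (σ : Matrix B B ℂ) :
    measurePrepare (t • M) σ = t • measurePrepare M σ := by
  ext ρ b b'
  simp [measurePrepare_apply, mul_assoc]

theorem IsMP.smul {Φ : Op A B} (hΦ : IsMP Φ) {t : ℝ} (ht : 0 ≤ t) : IsMP (t • Φ) := by
  obtain ⟨n, M, σ, hM, hσ, rfl⟩ := hΦ
  refine ⟨n, fun i => t • M i, σ, fun i => (hM i).smul ht, hσ, ?_⟩
  simp [measurePrepare_smul, Finset.smul_sum]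

theorem IsMP.isCP {Φ : Op A B} (hΦ : IsMP Φ) : IsCP Φ := by
  obtain ⟨n, M, σ, hM, hσ, rfl⟩ := hΦ
  exact IsCP.sum _ fun i _ => isCP_measurePrepare (hM i) (hσ i).1

theorem isTP_sum_measurePrepare [DecidableEq A] {ι : Type*} [Fintype ι] {M : ι → Matrix A A ℂ}
    {σ : ι → Matrix B B ℂ} (hσ : ∀ i, IsDensity (σ i)) :
    IsTP (∑ i, measurePrepare (M i) (σ i)) ↔ ∑ i, M i = 1 := by
  have h : ∀ ρ : Matrix A A ℂ, ((∑ i, measurePrepare (M i) (σ i)) ρ).trace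
      = (ρ * ∑ i, M i).trace := fun ρ => by
    simp [measurePrepare_apply, Matrix.trace_sum, Finset.mul_sum, (hσ _).2]
  constructor
  · intro h1
    refine Matrix.ext_iff_trace_mul_left.2 ?_
    intro ρ
    rw [← h, h1, mul_one]
  · intro h1 ρ
    rw [h, h1, mul_one]

variable [DecidableEq A]

/-- This splits EB into a convex cone and a linear constraint: trace preservation alone forces the
measurement operators to sum to `1`. Sums and multiples can then be handled without renormalizing a
POVM. -/
theorem isEB_iff {Φ : Op A B} : IsEB Φ ↔ IsMP Φ ∧ IsTP Φ := by
  constructor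
  · rintro ⟨n, M, σ, hM, h1, hσ, h⟩
    have : Φ = ∑ i, measurePrepare (M i) (σ i) := LinearMap.ext fun ρ => by
      rw [h]; simp [measurePrepare_apply]
    subst this
    exact ⟨⟨n, M, σ, hM, hσ, rfl⟩, (isTP_sum_measurePrepare hσ).2 h1⟩
  · rintro ⟨⟨n, M, σ, hM, hσ, rfl⟩, h⟩
    exact ⟨n, M, σ, hM, (isTP_sum_measurePrepare hσ).1 h, hσ, fun ρ => by
      simp [measurePrepare_apply]⟩

theorem IsEB.isChannel {Φ : Op A B} (h : IsEB Φ) : IsChannel Φ :=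
  ⟨(isEB_iff.1 h).1.isCP, (isEB_iff.1 h).2⟩

theorem IsEB.combine {Φ Ψ : Op A B} (hΦ : IsEB Φ) (hΨ : IsEB Ψ) {s t : ℝ} (hs : 0 ≤ s)
    (ht : 0 ≤ t) (hst : s + t = 1) : IsEB (s • Φ + t • Ψ) := by
  rw [isEB_iff] at *
  refine ⟨(hΦ.1.smul hs).add (hΨ.1.smul ht), fun X => ?_⟩
  simp only [LinearMap.add_apply, LinearMap.smul_apply, Matrix.trace_add, Matrix.trace_smul,
    hΦ.2 X, hΨ.2 X]
  rw [← add_smul, hst, one_smul]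

theorem IsEB.channel_comp {Ψ : Op B C} {Φ : Op A B} (hΨ : IsChannel Ψ) (hΦ : IsEB Φ) :
    IsEB (Ψ ∘ₗ Φ) := by
  obtain ⟨n, M, σ, hM, h1, hσ, h⟩ := hΦ
  exact ⟨n, M, fun i => Ψ (σ i), hM, h1,
    fun i => ⟨hΨ.1.posSemidef (hσ i).1, (hΨ.2 _).trans (hσ i).2⟩, fun ρ => by simp [h]⟩

end MeasurePrepare

/-! ### Robustness and its monotonicity -/

section Robustness

variable [Fintype A] [Fintype B] [Fintype C] [Fintype P]

theorem mem_robustnessSet_iff [DecidableEq A] {N : Op A B} {s : ℝ} :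
    s ∈ robustnessSet N ↔
      0 ≤ s ∧ ∃ M M' : Op A B, IsEB M ∧ IsEB M' ∧ N + s • M = (1 + s) • M' := by
  refine and_congr_right fun hs => exists_congr fun M => ?_
  have h1 : (1 + s) ≠ 0 := by positivity
  constructor
  · rintro ⟨hM, hM'⟩
    exact ⟨_, hM, hM', (smul_inv_smul₀ h1 _).symm⟩
  · rintro ⟨M', hM, hM', h⟩
    refine ⟨hM, ?_⟩
    rwa [h, inv_smul_smul₀ h1]

/-- Adding `(t - s) M'` to both sides of `N + s M = (1 + s) M'` raises the weight to `t`. Upward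
closure is what allows a real robustness to be rounded up to an integer. -/
theorem robustnessSet_mono [DecidableEq A] {N : Op A B} {s t : ℝ} (hs : s ∈ robustnessSet N)
    (hst : s ≤ t) :
    t ∈ robustnessSet N := by
  obtain rfl | hlt := hst.eq_or_lt
  · exact hs
  rw [mem_robustnessSet_iff] at hs ⊢
  obtain ⟨h0, M, M', hM, hM', h⟩ := hs
  have ht : 0 < t := h0.trans_lt hlt
  refine ⟨ht.le, (s / t) • M + ((t - s) / t) • M', M', ?_, hM', ?_⟩
  · exact hM.combine hM' (by positivity) (div_nonneg (by linarith) ht.le) (by field_simp; ring)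
  · rw [smul_add, smul_smul, smul_smul, mul_div_cancel₀ _ ht.ne', mul_div_cancel₀ _ ht.ne',
      ← add_assoc, h, ← add_smul]
    congr 1
    ring

theorem robustnessSet_channel_comp [DecidableEq A] {N : Op A B} {Ψ : Op B C}
    (hΨ : IsChannel Ψ) {s : ℝ} (hs : s ∈ robustnessSet N) : s ∈ robustnessSet (Ψ ∘ₗ N) := by
  rw [mem_robustnessSet_iff] at hs ⊢
  obtain ⟨h0, M, M', hM, hM', h⟩ := hs
  refine ⟨h0, Ψ ∘ₗ M, Ψ ∘ₗ M', hM.channel_comp hΨ, hM'.channel_comp hΨ, ?_⟩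
  rw [← LinearMap.comp_smul, ← LinearMap.comp_smul, ← LinearMap.comp_add, h]

theorem IsSuperchannel.map_add {Λ : Op A B → Op C P} (h : IsSuperchannel Λ)
    (Φ Ψ : Op A B) : Λ (Φ + Ψ) = Λ Φ + Λ Ψ := by
  obtain ⟨E, _, U, V, _, _, h⟩ := h
  rw [h, h, h, ampl_add, LinearMap.add_comp, LinearMap.comp_add]

theorem IsSuperchannel.map_smul {Λ : Op A B → Op C P} (h : IsSuperchannel Λ)
    (t : ℝ) (Φ : Op A B) : Λ (t • Φ) = t • Λ Φ := by
  obtain ⟨E, _, U, V, _, _, h⟩ := h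
  have h1 : ampl E (t • Φ) = t • ampl E Φ := rfl
  rw [h, h, h1, LinearMap.smul_comp, LinearMap.comp_smul]

theorem IsSuperchannel.isChannel {Λ : Op A B → Op C P} (h : IsSuperchannel Λ)
    {Φ : Op A B} (hΦ : IsChannel Φ) : IsChannel (Λ Φ) := by
  obtain ⟨E, _, U, V, hU, hV, h⟩ := h
  rw [h]
  exact hV.comp (hΦ.ampl.comp hU)

theorem IsFree.robustnessSet_subset [DecidableEq A] [DecidableEq C] {Λ : Op A B → Op C P}
    (h : IsFree Λ) (N : Op A B) : robustnessSet N ⊆ robustnessSet (Λ N) := by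
  intro s hs
  rw [mem_robustnessSet_iff] at hs ⊢
  obtain ⟨h0, M, M', hM, hM', h1⟩ := hs
  refine ⟨h0, Λ M, Λ M', h.2 M hM, h.2 M' hM', ?_⟩
  rw [← h.1.map_smul, ← h.1.map_smul, ← h.1.map_add, h1]

end Robustness

/-! ### The robustness of the identity is at most the dimension minus one -/

section Identity

variable [Fintype D] [DecidableEq D]

/-- The vector of cubic phases with exponents `θ`. -/
def phaseVector (θ : D → ZMod 3) (a : D) : ℂ := ZMod.stdAddChar (θ a)

/-- The summand is a character of `(ZMod 3)^D`, so its sum vanishes unless the exponent `θ a - θ b +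
θ c - θ d` is identically zero. Signs would not do: modulo 2 the case `a = c`, `b = d` would survive
as well. -/
theorem sum_phaseVector (a b c d : D) :
    ∑ θ : D → ZMod 3, phaseVector θ a * star (phaseVector θ b) *
      (phaseVector θ c * star (phaseVector θ d)) =
      if (a = b ∧ c = d) ∨ (a = d ∧ b = c) then (3 : ℂ) ^ Fintype.card D else 0 := by
  let ev : ∀ i, (D → ZMod 3) →+ ZMod 3 := fun i => Pi.evalAddMonoidHom (fun _ => ZMod 3) i
  let f : (D → ZMod 3) →+ ZMod 3 := ev a - ev b + (ev c - ev d)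
  let ψ : AddChar (D → ZMod 3) ℂ := (ZMod.stdAddChar (N := 3)).compAddMonoidHom f
  have hf : ∀ θ, f θ = θ a - θ b + (θ c - θ d) := fun θ => rfl
  have hψ : ∀ θ, phaseVector θ a * star (phaseVector θ b) *
      (phaseVector θ c * star (phaseVector θ d)) = ψ θ := by
    intro θ
    change _ = ZMod.stdAddChar (f θ)
    have hstar : ∀ x : ZMod 3, star (ZMod.stdAddChar x : ℂ) = ZMod.stdAddChar (-x) := fun x => by
      rw [AddChar.map_neg_eq_conj]; rfl
    simp only [phaseVector, hstar, hf, sub_eq_add_neg, AddChar.map_add_eq_mul]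
  simp only [hψ]
  rw [AddChar.sum_eq_ite]
  have h0 : ψ = 0 ↔ ∀ θ, f θ = 0 := by
    rw [AddChar.ext_iff]
    refine forall_congr' fun θ => ?_
    change ZMod.stdAddChar (f θ) = 1 ↔ _
    rw [← AddChar.map_zero_eq_one (ZMod.stdAddChar (N := 3)) (M := ℂ)]
    exact ZMod.injective_stdAddChar.eq_iff
  have h1 : ψ = 0 ↔ (a = b ∧ c = d) ∨ (a = d ∧ b = c) := by
    rw [h0]
    constructor
    · intro h
      -- Evaluating the exponent at the indicators of `a` and of `c` forces the pairing of indices;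
      -- `1 + 1 ≠ 0` handles `a = c`.
      have ha := h (Pi.single a 1)
      have hc := h (Pi.single c 1)
      simp only [hf, Pi.single_apply] at ha hc
      have e2 : (1 : ZMod 3) + 1 ≠ 0 := by decide
      by_cases hab : a = b
      · subst hab
        by_cases hcd : c = d
        · exact Or.inl ⟨rfl, hcd⟩
        · simp [Ne.symm hcd] at hc
      · by_cases had : a = d
        · subst had
          by_cases hbc : b = c
          · exact Or.inr ⟨rfl, hbc⟩
          · simp [hbc] at hc
        · by_cases hca : c = a <;> simp [Ne.symm hab, Ne.symm had, hca, e2] at ha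
    · rintro (⟨rfl, rfl⟩ | ⟨rfl, rfl⟩) θ <;> rw [hf] <;> ring
  by_cases h2 : (a = b ∧ c = d) ∨ (a = d ∧ b = c)
  · rw [if_pos h2, if_pos (h1.2 h2)]
    simp
  · rw [if_neg h2, if_neg (h1.not.2 h2)]

/-- The measurement along the vectors of cubic phases, which prepares the observed vector. -/
def phaseMeasurement (D : Type*) [Fintype D] [DecidableEq D] : Op D D :=
  ∑ θ : D → ZMod 3, measurePrepare
    (((3 : ℝ) ^ Fintype.card D)⁻¹ • Matrix.vecMulVec (phaseVector θ) (star (phaseVector θ)))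
    ((Fintype.card D : ℝ)⁻¹ • Matrix.vecMulVec (phaseVector θ) (star (phaseVector θ)))

/-- The two index pairings in the fourth moment give `Tr ρ · 1` and `ρ`; their overlap, counted
once, removes the diagonal. Uniformly random unit vectors would leave `ρ + Tr ρ · 1`, whose extra
term has weight `d` instead of `d - 1`. -/
theorem card_smul_phaseMeasurement [Nonempty D] (ρ : Matrix D D ℂ) :
    ((Fintype.card D : ℝ) • phaseMeasurement D) ρ =
      ρ + (ρ.trace • 1 - Matrix.diagonal ρ.diag) := by
  have hd : (Fintype.card D : ℂ) ≠ 0 := by simp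
  have h3 : (3 : ℂ) ^ Fintype.card D ≠ 0 := by positivity
  ext b b'
  have h1 : ((Fintype.card D : ℝ) • phaseMeasurement D) ρ b b' =
      ((3 : ℂ) ^ Fintype.card D)⁻¹ * ∑ x, ∑ y, ρ x y * ∑ θ : D → ZMod 3,
        phaseVector θ y * star (phaseVector θ x) * (phaseVector θ b * star (phaseVector θ b')) := by
    simp only [phaseMeasurement, LinearMap.smul_apply, LinearMap.sum_apply, measurePrepare_apply,
      Matrix.smul_apply, Matrix.sum_apply, Matrix.vecMulVec_apply, Matrix.trace, Matrix.diag,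
      Matrix.mul_apply, Finset.mul_sum, Complex.real_smul, smul_eq_mul, Finset.sum_mul,
      Pi.star_apply]
    rw [Finset.sum_comm]
    refine Finset.sum_congr rfl fun x _ => ?_
    rw [Finset.sum_comm]
    refine Finset.sum_congr rfl fun y _ => Finset.sum_congr rfl fun θ _ => ?_
    push_cast
    field_simp
  rw [h1]
  -- Inclusion-exclusion for the indicator of the union of the two pairings.
  have h2 : ∀ x y, (if (y = x ∧ b = b') ∨ (y = b' ∧ x = b) then (3 : ℂ) ^ Fintype.card D else 0) =
      (3 : ℂ) ^ Fintype.card D * ((if y = x then if b = b' then 1 else 0 else 0) +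
        (if y = b' then if x = b then 1 else 0 else 0) -
        (if y = x then if x = b then if b = b' then 1 else 0 else 0 else 0)) := by
    intro x y
    by_cases h4 : y = x <;> by_cases h5 : b = b' <;> by_cases h6 : x = b <;>
      by_cases h7 : y = b' <;> simp_all
  simp only [sum_phaseVector, h2, mul_left_comm (ρ _ _), ← Finset.mul_sum, inv_mul_cancel_left₀ h3,
    mul_add, mul_sub, Finset.sum_add_distrib, Finset.sum_sub_distrib]
  simp only [mul_ite, mul_one, mul_zero, Finset.sum_ite_eq', Finset.mem_univ, if_true,
    Matrix.add_apply, Matrix.sub_apply, Matrix.smul_apply, Matrix.one_apply,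
    Matrix.diagonal_apply, Matrix.diag, Matrix.trace, Finset.sum_ite_eq, smul_eq_mul]
  by_cases hb : b = b'
  · simp only [hb, if_true]
    ring
  · simp [hb]

/-- The measurement in the computational basis, followed by the preparation of the projector on
the other basis vectors. -/
def otherBasisVectors (D : Type*) [Fintype D] [DecidableEq D] : Op D D :=
  ∑ a : D, measurePrepare (Matrix.single a a 1) (1 - Matrix.single a a 1)

theorem otherBasisVectors_apply (ρ : Matrix D D ℂ) :
    otherBasisVectors D ρ = ρ.trace • 1 - Matrix.diagonal ρ.diag := by
  simp only [otherBasisVectors, LinearMap.sum_apply, measurePrepare_apply, smul_sub,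
    Finset.sum_sub_distrib, ← Finset.sum_smul]
  congr 1
  · simp only [Matrix.trace_mul_single]
    simp [Matrix.trace]
  · ext b b'
    by_cases h : b = b' <;>
      simp +contextual [Matrix.sum_apply, Matrix.single_apply, h, Matrix.trace_mul_single]

theorem isTP_phaseMeasurement [Nonempty D] : IsTP (phaseMeasurement D) := fun ρ => by
  have hd : (Fintype.card D : ℂ) ≠ 0 := by simp
  have h := congrArg Matrix.trace (card_smul_phaseMeasurement ρ)
  simp only [LinearMap.smul_apply, Matrix.trace_smul, Matrix.trace_add, Matrix.trace_sub,
    Matrix.trace_one, Matrix.trace_diagonal, Complex.real_smul, Complex.ofReal_natCast] at h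
  refine mul_left_cancel₀ hd (h.trans ?_)
  simp [Matrix.trace, mul_comm]

theorem isEB_phaseMeasurement [Nonempty D] : IsEB (phaseMeasurement D) := by
  refine isEB_iff.2 ⟨IsMP.of_fintype (fun θ => ?_) fun θ => ⟨?_, ?_⟩, isTP_phaseMeasurement⟩
  · exact (Matrix.posSemidef_vecMulVec_self_star _).smul (by positivity)
  · exact (Matrix.posSemidef_vecMulVec_self_star _).smul (by positivity)
  · have h : ∀ a, phaseVector θ a * star (phaseVector θ a) = 1 := fun a => by
      simp [phaseVector, ← AddChar.map_neg_eq_conj, ← AddChar.map_add_eq_mul]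
    have h1 : (Matrix.vecMulVec (phaseVector θ) (star (phaseVector θ))).trace = Fintype.card D := by
      change ∑ a, phaseVector θ a * star (phaseVector θ a) = _
      simp only [h]
      simp
    rw [Matrix.trace_smul, h1]
    simp

omit [Fintype D] in
theorem posSemidef_one_sub_single (a : D) :
    (1 - Matrix.single a a (1 : ℂ)).PosSemidef := by
  have h : (1 - Matrix.single a a (1 : ℂ)) = Matrix.diagonal fun b => if b = a then 0 else 1 := by
    ext b b'
    by_cases h1 : b = b' <;> by_cases h2 : b = a <;>
      simp_all [Matrix.single_apply, Matrix.one_apply, eq_comm]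
  rw [h]
  refine Matrix.PosSemidef.diagonal fun b => ?_
  by_cases h : b = a <;> simp [h]

theorem isEB_smul_otherBasisVectors (hD : 1 < Fintype.card D) :
    IsEB (((Fintype.card D : ℝ) - 1)⁻¹ • otherBasisVectors D) := by
  have hD' : (1 : ℝ) < Fintype.card D := by exact_mod_cast hD
  have h0 : (Fintype.card D : ℝ) - 1 ≠ 0 := by linarith
  have h0' : (Fintype.card D : ℂ) - 1 ≠ 0 := by exact_mod_cast h0
  have h1 : ((Fintype.card D : ℝ) - 1)⁻¹ • otherBasisVectors D =
      ∑ a : D, measurePrepare (Matrix.single a a 1)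
        (((Fintype.card D : ℝ) - 1)⁻¹ • (1 - Matrix.single a a 1)) := by
    rw [otherBasisVectors, Finset.smul_sum]
    refine Finset.sum_congr rfl fun a _ => LinearMap.ext fun ρ => ?_
    rw [LinearMap.smul_apply, measurePrepare_apply, measurePrepare_apply, smul_comm]
  refine isEB_iff.2 ⟨?_, fun ρ => ?_⟩
  · rw [h1]
    refine IsMP.of_fintype (fun a => ?_) fun a => ⟨?_, ?_⟩
    · rw [← Matrix.diagonal_single]
      exact Matrix.PosSemidef.diagonal (Pi.single_nonneg.2 zero_le_one)
    · exact (posSemidef_one_sub_single a).smul (inv_nonneg.2 (by linarith))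
    · simp [Matrix.trace_smul, Matrix.trace_sub, h0']
  · rw [LinearMap.smul_apply, otherBasisVectors_apply, Matrix.trace_smul, Matrix.trace_sub,
      Matrix.trace_smul, Matrix.trace_one, Matrix.trace_diagonal, Complex.real_smul]
    change _ * (_ - ρ.trace) = _
    push_cast
    simp only [smul_eq_mul]
    field_simp

theorem card_sub_one_mem_robustnessSet_id [Nonempty D] :
    (Fintype.card D : ℝ) - 1 ∈ robustnessSet (LinearMap.id : Op D D) := by
  rw [mem_robustnessSet_iff]
  have hD : 1 ≤ Fintype.card D := Fintype.card_pos
  have hD' : (1 : ℝ) ≤ Fintype.card D := by exact_mod_cast hD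
  have h : (LinearMap.id : Op D D) + otherBasisVectors D =
      (Fintype.card D : ℝ) • phaseMeasurement D := LinearMap.ext fun ρ => by
    rw [card_smul_phaseMeasurement, LinearMap.add_apply, otherBasisVectors_apply,
      LinearMap.id_apply]
  refine ⟨by linarith, ?_⟩
  rw [add_sub_cancel]
  -- In dimension one the added map is zero and cannot be normalized; its weight is zero too, so any
  -- EB map serves.
  obtain h1 | h1 := hD.eq_or_lt
  · refine ⟨phaseMeasurement D, phaseMeasurement D, isEB_phaseMeasurement,
      isEB_phaseMeasurement, ?_⟩
    have h2 : otherBasisVectors D = 0 := LinearMap.ext fun ρ => by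
      have : Subsingleton D := Fintype.card_le_one_iff_subsingleton.1 h1.ge
      rw [otherBasisVectors_apply]
      ext a b
      obtain rfl := Subsingleton.elim a b
      simp [Matrix.trace, Fintype.sum_subsingleton _ a]
    rw [← h, h2, ← h1]
    simp
  · have h1' : (1 : ℝ) < Fintype.card D := by exact_mod_cast h1
    exact ⟨_, phaseMeasurement D, isEB_smul_otherBasisVectors h1, isEB_phaseMeasurement, by
      rw [smul_inv_smul₀ (by linarith), h]⟩

/-- Since `N = N ∘ id`, the bound for the identity on the input passes to `N`. In particular, the
infimum that defines the robustness is over a nonempty set. -/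
theorem card_sub_one_mem_robustnessSet [Fintype A] [DecidableEq A] [Nonempty A] [Fintype B]
    {N : Op A B} (hN : IsChannel N) : (Fintype.card A : ℝ) - 1 ∈ robustnessSet N := by
  have h := robustnessSet_channel_comp hN (card_sub_one_mem_robustnessSet_id (D := A))
  rwa [LinearMap.comp_id] at h

end Identity

/-! ### Compactness of convex hulls -/

section ConvexHull

variable [AddCommGroup E] [Module ℝ E] [TopologicalSpace E] [IsTopologicalAddGroup E]
  [ContinuousSMul ℝ E]

theorem isCompact_convexJoin {s t : Set E} (hs : IsCompact s) (ht : IsCompact t) :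
    IsCompact (convexJoin ℝ s t) := by
  have h : convexJoin ℝ s t =
      (fun p : ℝ × E × E => p.2.1 + p.1 • (p.2.2 - p.2.1)) '' (Set.Icc 0 1 ×ˢ s ×ˢ t) := by
    ext x
    simp only [mem_convexJoin, segment_eq_image', Set.mem_image, Set.mem_prod, Prod.exists]
    constructor
    · rintro ⟨a, ha, b, hb, θ, hθ, rfl⟩
      exact ⟨θ, a, b, ⟨hθ, ha, hb⟩, rfl⟩
    · rintro ⟨θ, a, b, ⟨hθ, ha, hb⟩, rfl⟩
      exact ⟨a, ha, b, hb, θ, hθ, rfl⟩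
  rw [h]
  exact (isCompact_Icc.prod (hs.prod ht)).image (by fun_prop)

/-- In finite dimension, the convex hull of a compact set is compact. -/
theorem isCompact_convexHull [FiniteDimensional ℝ E] {s : Set E} (hs : IsCompact s) :
    IsCompact (convexHull ℝ s) := by
  classical
  obtain rfl | hne := s.eq_empty_or_nonempty
  · simp
  let J : ℕ → Set E := fun n => (convexJoin ℝ s)^[n] s
  have hJs : ∀ n, J (n + 1) = convexJoin ℝ s (J n) := fun n => Function.iterate_succ_apply' ..
  have hJc : ∀ n, IsCompact (J n) := by
    intro n
    induction n with
    | zero => exact hs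
    | succ n ih => rw [hJs]; exact isCompact_convexJoin hs ih
  have hJm : Monotone J := monotone_nat_of_le_succ fun n => by
    rw [hJs]; exact subset_convexJoin_right hne
  have hJsub : ∀ n, J n ⊆ convexHull ℝ s := by
    intro n
    induction n with
    | zero => exact subset_convexHull ℝ s
    | succ n ih =>
      rw [hJs]
      exact convexJoin_subset (subset_convexHull ℝ s) ih (convex_convexHull ℝ s)
  have hJt : ∀ t : Finset E, (t : Set E) ⊆ s → convexHull ℝ (t : Set E) ⊆ J t.card := by
    intro t
    induction t using Finset.induction_on with
    | empty => simp
    | insert x t hx ih =>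
      intro ht
      rw [Finset.coe_insert, Set.insert_subset_iff] at ht
      rw [Finset.card_insert_of_notMem hx, Finset.coe_insert]
      obtain rfl | ht' := t.eq_empty_or_nonempty
      · simpa using hJm (Nat.zero_le 1) ht.1
      · rw [convexHull_insert (by simpa using ht'), hJs]
        exact convexJoin_mono (by simpa using ht.1) (ih ht.2)
  -- Carathéodory: affinely independent points number at most `finrank + 1`, so finitely many joins
  -- with `s` exhaust the hull.
  have h : convexHull ℝ s = J (Module.finrank ℝ E + 1) := by
    refine Set.Subset.antisymm ?_ (hJsub _)
    rw [convexHull_eq_union]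
    refine Set.iUnion_subset fun t => Set.iUnion_subset fun hts => Set.iUnion_subset fun hind => ?_
    refine (hJt t hts).trans (hJm ?_)
    have h1 := hind.card_le_finrank_succ
    rw [Fintype.card_coe] at h1
    exact h1.trans (Nat.succ_le_succ (Submodule.finrank_le _))
  rw [h]
  exact hJc _

end ConvexHull

/-! ### Bounds and closedness for positive semidefinite matrices -/

section PosSemidef

/-- The principal minor on the indices `i`, `j` is nonnegative. -/
theorem norm_sq_le_of_posSemidef {S : Matrix A A ℂ} (hS : S.PosSemidef) (i j : A) :
    ‖S i j‖ ^ 2 ≤ (S i i).re * (S j j).re := by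
  have h := (hS.submatrix ![i, j]).det_nonneg
  have hi := hS.diag_nonneg (i := i)
  have hj := hS.diag_nonneg (i := j)
  have hij : S j i = star (S i j) := (hS.isHermitian.apply j i).symm
  rw [Matrix.det_fin_two] at h
  simp only [Matrix.submatrix_apply, Matrix.cons_val_zero, Matrix.cons_val_one, hij] at h
  rw [Complex.le_def] at h hi hj
  have h1 : (S i j * star (S i j)) = ((‖S i j‖ ^ 2 : ℝ) : ℂ) := by
    push_cast
    exact Complex.mul_conj' _
  have h2 := h.1
  rw [h1, Complex.sub_re, Complex.mul_re, Complex.ofReal_re, ← hi.2] at h2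
  simp at h2
  linarith

variable [Fintype A]

theorem re_diag_le_trace {S : Matrix A A ℂ} (hS : S.PosSemidef) (i : A) :
    (S i i).re ≤ S.trace.re := by
  simp only [Matrix.trace, Matrix.diag, Complex.re_sum]
  exact Finset.single_le_sum (f := fun i => (S i i).re)
    (fun j _ => (Complex.le_def.1 (hS.diag_nonneg (i := j))).1) (Finset.mem_univ i)

theorem norm_le_trace {S : Matrix A A ℂ} (hS : S.PosSemidef) (i j : A) :
    ‖S i j‖ ≤ S.trace.re := by
  have hi := (Complex.le_def.1 (hS.diag_nonneg (i := i))).1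
  have hj := (Complex.le_def.1 (hS.diag_nonneg (i := j))).1
  have h := norm_sq_le_of_posSemidef hS i j
  have h1 := re_diag_le_trace hS i
  have h2 := re_diag_le_trace hS j
  simp only [Complex.zero_re] at hi hj
  exact abs_le_of_sq_le_sq' (by nlinarith) (hi.trans h1) |>.2

/-- Bound each entry by the minors of `M` and `S`, then use the arithmetic-geometric mean
inequality; the resulting double sum factors. -/
theorem re_trace_mul_le {M S : Matrix A A ℂ} (hM : M.PosSemidef) (hS : S.PosSemidef) :
    (M * S).trace.re ≤ M.trace.re * S.trace.re := by
  have h0 : ∀ {T : Matrix A A ℂ}, T.PosSemidef → ∀ i, 0 ≤ (T i i).re := fun hT i =>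
    (Complex.le_def.1 (hT.diag_nonneg (i := i))).1
  have h1 : ∀ a b, (M a b * S b a).re ≤
      ((M a a).re * (S b b).re + (M b b).re * (S a a).re) / 2 := by
    intro a b
    refine (Complex.re_le_norm _).trans ?_
    have h2 : ‖M a b * S b a‖ ^ 2 ≤ ((M a a).re * (S b b).re) * ((M b b).re * (S a a).re) := by
      rw [norm_mul, mul_pow]
      calc _ ≤ ((M a a).re * (M b b).re) * ((S b b).re * (S a a).re) :=
            mul_le_mul (norm_sq_le_of_posSemidef hM a b) (norm_sq_le_of_posSemidef hS b a)
              (by positivity) (mul_nonneg (h0 hM a) (h0 hM b))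
        _ = _ := by ring
    have h3 := mul_nonneg (h0 hM a) (h0 hS b)
    have h4 := mul_nonneg (h0 hM b) (h0 hS a)
    refine abs_le_of_sq_le_sq' ?_ (by linarith) |>.2
    nlinarith [sq_nonneg ((M a a).re * (S b b).re - (M b b).re * (S a a).re)]
  have h5 : (M * S).trace.re = ∑ a, ∑ b, (M a b * S b a).re := by
    simp [Matrix.trace, Matrix.mul_apply]
  rw [h5]
  calc _ ≤ ∑ a, ∑ b, ((M a a).re * (S b b).re + (M b b).re * (S a a).re) / 2 :=
        Finset.sum_le_sum fun a _ => Finset.sum_le_sum fun b _ => h1 a b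
    _ = M.trace.re * S.trace.re := by
      simp only [← Finset.sum_div, Finset.sum_add_distrib, ← Finset.mul_sum, ← Finset.sum_mul,
        Matrix.trace, Matrix.diag, Complex.re_sum]
      ring

theorem isClosed_posSemidef : IsClosed {S : Matrix A A ℂ | S.PosSemidef} := by
  have h : {S : Matrix A A ℂ | S.PosSemidef} = {S | S.conjTranspose = S} ∩
      ⋂ x : A → ℂ, {S | 0 ≤ star x ⬝ᵥ (S.mulVec x)} := by
    ext S
    simp [Matrix.posSemidef_iff_dotProduct_mulVec, Matrix.IsHermitian]
  rw [h]
  refine (isClosed_eq continuous_id.matrix_conjTranspose continuous_id).inter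
    (isClosed_iInter fun x => ?_)
  exact isClosed_le continuous_const (by fun_prop)

theorem isCompact_posSemidef_trace_le (c : ℝ) :
    IsCompact {S : Matrix A A ℂ | S.PosSemidef ∧ S.trace.re ≤ c} := by
  have h1 : IsCompact (Set.univ.pi fun _ : A => Set.univ.pi fun _ : A =>
      Metric.closedBall (0 : ℂ) c) :=
    isCompact_univ_pi fun _ => isCompact_univ_pi fun _ => isCompact_closedBall _ _
  have h2 : IsClosed {S : Matrix A A ℂ | S.PosSemidef ∧ S.trace.re ≤ c} :=
    isClosed_posSemidef.inter (isClosed_le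
      (Complex.continuous_re.comp continuous_id.matrix_trace) continuous_const)
  refine h1.of_isClosed_subset h2 fun S hS => ?_
  simp only [Set.mem_univ_pi, mem_closedBall_zero_iff]
  exact fun i j => (norm_le_trace hS.1 i j).trans hS.2

theorem isCompact_isDensity : IsCompact {S : Matrix A A ℂ | IsDensity S} := by
  refine (isCompact_posSemidef_trace_le 1).of_isClosed_subset
    (isClosed_posSemidef.inter (isClosed_eq (f := Matrix.trace) (by fun_prop) continuous_const))
    fun S hS => ⟨hS.1, ?_⟩
  rw [hS.2, Complex.one_re]

/-- Uniqueness of the positive square root avoids its continuity: the sublevel set is the preimage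
under `X ↦ X† X` of the squares of a compact set of positive matrices. -/
theorem isClosed_traceNorm_le [DecidableEq A] (c : ℝ) :
    IsClosed {X : Matrix A A ℂ | traceNorm X ≤ c} := by
  have h : {X : Matrix A A ℂ | traceNorm X ≤ c} = (fun X => X.conjTranspose * X) ⁻¹'
      ((fun S => S * S) '' {S : Matrix A A ℂ | S.PosSemidef ∧ S.trace.re ≤ c}) := by
    ext X
    have hX : 0 ≤ X.conjTranspose * X :=
      Matrix.nonneg_iff_posSemidef.2 (Matrix.posSemidef_conjTranspose_mul_self X)
    constructor
    · intro h
      exact ⟨_, ⟨Matrix.nonneg_iff_posSemidef.1 (CFC.sqrt_nonneg _), h⟩,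
        CFC.sqrt_mul_sqrt_self _ hX⟩
    · rintro ⟨S, ⟨hS, hc⟩, h⟩
      have h1 := CFC.sqrt_unique h (Matrix.nonneg_iff_posSemidef.2 hS)
      change (CFC.sqrt (X.conjTranspose * X)).trace.re ≤ c
      rwa [h1]
  rw [h]
  exact ((isCompact_posSemidef_trace_le c).image (by fun_prop)).isClosed.preimage (by fun_prop)

theorem exists_isDensity [Nonempty A] : ∃ S : Matrix A A ℂ, IsDensity S := by
  classical
  obtain ⟨a⟩ := ‹Nonempty A›
  refine ⟨Matrix.single a a 1, ?_, by simp⟩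
  rw [← Matrix.diagonal_single]
  exact Matrix.PosSemidef.diagonal (Pi.single_nonneg.2 zero_le_one)

theorem exists_isDensity_smul [Nonempty A] {M : Matrix A A ℂ} (hM : M.PosSemidef) :
    ∃ S : Matrix A A ℂ, IsDensity S ∧ M = M.trace.re • S := by
  have h0 := Complex.le_def.1 hM.trace_nonneg
  have h1 : (M.trace.re : ℂ) = M.trace := Complex.ext (by simp) (by simpa using h0.2)
  by_cases h : M.trace = 0
  · obtain ⟨S, hS⟩ := exists_isDensity (A := A)
    refine ⟨S, hS, ?_⟩
    rw [h, hM.trace_eq_zero_iff.1 h]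
    simp
  · have h2 : M.trace.re ≠ 0 := fun h3 => h (by rw [← h1, h3, Complex.ofReal_zero])
    refine ⟨M.trace.re⁻¹ • M, ⟨hM.smul (inv_nonneg.2 h0.1), ?_⟩, (smul_inv_smul₀ h2 M).symm⟩
    rw [Matrix.trace_smul, Complex.real_smul, Complex.ofReal_inv, h1, inv_mul_cancel₀ h]

end PosSemidef

/-! ### Compactness of the EB channels and attainment of the minima -/

section Compactness

variable [Fintype A] [DecidableEq A] [Fintype B] [DecidableEq B]

/-- The matrix of a super-operator in the bases of matrix units. -/
def coords (A B : Type*) [Fintype A] [DecidableEq A] [Fintype B] [DecidableEq B] :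
    Op A B ≃ₗ[ℝ] Matrix (B × B) (A × A) ℂ :=
  (LinearMap.toMatrix (Matrix.stdBasis ℂ A A) (Matrix.stdBasis ℂ B B)).restrictScalars ℝ

theorem coords_apply (Φ : Op A B) (b : B × B) (a : A × A) :
    coords A B Φ b a = Φ (Matrix.single a.1 a.2 1) b.1 b.2 := by
  change LinearMap.toMatrix _ _ Φ b a = _
  rw [LinearMap.toMatrix_apply, Matrix.stdBasis_eq_single]
  simp [Matrix.stdBasis]

theorem continuous_linear_coords_symm {F : Type*} [AddCommGroup F] [Module ℝ F]
    [TopologicalSpace F] [IsTopologicalAddGroup F] [ContinuousSMul ℝ F] (f : Op A B →ₗ[ℝ] F) :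
    Continuous fun x => f ((coords A B).symm x) :=
  (f ∘ₗ (coords A B).symm.toLinearMap).continuous_of_finiteDimensional

theorem continuous_coords_symm_apply (X : Matrix A A ℂ) :
    Continuous fun x => (coords A B).symm x X :=
  continuous_linear_coords_symm
    { toFun := fun Φ : Op A B => Φ X
      map_add' := fun _ _ => rfl
      map_smul' := fun _ _ => rfl }

theorem continuous_ampl_coords_symm_apply (X : Matrix (A × E) (A × E) ℂ) :
    Continuous fun x => ampl E ((coords A B).symm x) X :=
  continuous_linear_coords_symm
    { toFun := fun Φ : Op A B => ampl E Φ X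
      map_add' := fun _ _ => rfl
      map_smul' := fun _ _ => rfl }

theorem isClosed_isTP : IsClosed ((coords A B).symm ⁻¹' {Φ | IsTP Φ}) := by
  have h : (coords A B).symm ⁻¹' {Φ | IsTP Φ} =
      ⋂ X : Matrix A A ℂ, {x | ((coords A B).symm x X).trace = X.trace} := by
    ext x
    simp [IsTP]
  rw [h]
  exact isClosed_iInter fun X =>
    isClosed_eq (continuous_coords_symm_apply X).matrix_trace continuous_const

theorem isClosed_isCP : IsClosed ((coords A B).symm ⁻¹' {Φ | IsCP Φ}) := by
  have h : (coords A B).symm ⁻¹' {Φ | IsCP Φ} =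
      ⋂ (k : ℕ) (X : Matrix (A × Fin k) (A × Fin k) ℂ) (_ : X.PosSemidef),
        {x | (ampl (Fin k) ((coords A B).symm x) X).PosSemidef} := by
    ext x
    simp [IsCP]
  rw [h]
  exact isClosed_iInter fun k => isClosed_iInter fun X => isClosed_iInter fun _ =>
    isClosed_posSemidef.preimage (continuous_ampl_coords_symm_apply X)

theorem isClosed_channelBall {ε : ℝ} (hε : 0 ≤ ε) (N : Op A B) :
    IsClosed ((coords A B).symm ⁻¹' channelBall ε N) := by
  have h : (coords A B).symm ⁻¹' channelBall ε N =
      ((coords A B).symm ⁻¹' {Φ | IsCP Φ} ∩ (coords A B).symm ⁻¹' {Φ | IsTP Φ}) ∩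
      ⋂ (k : ℕ) (X : Matrix (A × Fin k) (A × Fin k) ℂ) (_ : traceNorm X ≤ 1),
        {x | traceNorm (ampl (Fin k) ((coords A B).symm x) X - ampl (Fin k) N X) ≤ ε} := by
    ext x
    have h1 : ∀ (k : ℕ) (X : Matrix (A × Fin k) (A × Fin k) ℂ),
      ampl (Fin k) ((coords A B).symm x - N) X =
        ampl (Fin k) ((coords A B).symm x) X - ampl (Fin k) N X := fun _ _ => rfl
    simp [channelBall, IsChannel, diamondNorm, ENNReal.ofReal_le_ofReal_iff hε, h1]
  rw [h]
  refine (isClosed_isCP.inter isClosed_isTP).inter (isClosed_iInter fun k =>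
    isClosed_iInter fun X => isClosed_iInter fun _ => ?_)
  exact (isClosed_traceNorm_le ε).preimage
    ((continuous_ampl_coords_symm_apply X).sub continuous_const)

/-- The elementary measure-and-prepare maps with a measurement operator of trace `|A|`. -/
def elementaryMaps (A B : Type*) [Fintype A] [DecidableEq A] [Fintype B] [DecidableEq B] :
    Set (Matrix (B × B) (A × A) ℂ) :=
  (fun p : Matrix A A ℂ × Matrix B B ℂ =>
    coords A B (measurePrepare ((Fintype.card A : ℝ) • p.1) p.2)) ''
      ({P | IsDensity P} ×ˢ {σ | IsDensity σ})

theorem isCompact_elementaryMaps : IsCompact (elementaryMaps A B) := by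
  refine (isCompact_isDensity.prod isCompact_isDensity).image ?_
  refine continuous_pi fun b => continuous_pi fun a => ?_
  simp only [coords_apply, measurePrepare_apply]
  fun_prop

theorem convexHull_elementaryMaps_subset :
    convexHull ℝ (elementaryMaps A B) ⊆ (coords A B).symm ⁻¹' {Φ | IsMP Φ} := by
  refine convexHull_min ?_ ?_
  · rintro _ ⟨⟨P, σ⟩, ⟨hP, hσ⟩, rfl⟩
    have h := IsMP.of_fintype (ι := Unit) (M := fun _ => (Fintype.card A : ℝ) • P)
      (σ := fun _ => σ) (fun _ => hP.1.smul (by positivity)) fun _ => hσ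
    simpa using h
  · intro x hx y hy s t hs ht _
    have h := (IsMP.smul hx hs).add (IsMP.smul hy ht)
    simpa using h

/-- The traces of a POVM sum to `|A|`, so the numbers `Tr Mᵢ / |A|` are convex weights once each
operator is rescaled to trace `|A|`. -/
theorem preimage_isEB [Nonempty A] : (coords A B).symm ⁻¹' {Φ | IsEB Φ} =
    convexHull ℝ (elementaryMaps A B) ∩ (coords A B).symm ⁻¹' {Φ | IsTP Φ} := by
  refine Set.Subset.antisymm (fun x hx => ⟨?_, (isEB_iff.1 hx).2⟩)
    fun x hx => isEB_iff.2 ⟨convexHull_elementaryMaps_subset hx.1, hx.2⟩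
  obtain ⟨⟨n, M, σ, hM, hσ, h⟩, hTP⟩ := isEB_iff.1 hx
  have hTP' := hTP
  rw [h, isTP_sum_measurePrepare hσ] at hTP'
  choose S hS hMS using fun i => exists_isDensity_smul (hM i)
  have hA : (Fintype.card A : ℝ) ≠ 0 := by simp
  have h1 : x = ∑ i, ((M i).trace.re / Fintype.card A) •
      coords A B (measurePrepare ((Fintype.card A : ℝ) • S i) (σ i)) := by
    rw [← (coords A B).apply_symm_apply x, h, map_sum]
    refine Finset.sum_congr rfl fun i _ => ?_
    rw [measurePrepare_smul, map_smul, smul_smul, div_mul_cancel₀ _ hA, ← map_smul,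
      ← measurePrepare_smul, ← hMS]
  rw [h1]
  refine (convex_convexHull ℝ _).sum_mem (fun i _ => ?_) ?_ fun i _ =>
    subset_convexHull ℝ _ ⟨(S i, σ i), ⟨hS i, hσ i⟩, rfl⟩
  · exact div_nonneg (Complex.le_def.1 (hM i).trace_nonneg).1 (by positivity)
  · rw [← Finset.sum_div, ← Complex.re_sum, ← Matrix.trace_sum, hTP', Matrix.trace_one]
    simp

theorem isCompact_isEB [Nonempty A] : IsCompact ((coords A B).symm ⁻¹' {Φ | IsEB Φ}) := by
  rw [preimage_isEB]
  exact (isCompact_convexHull isCompact_elementaryMaps).inter_right isClosed_isTP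

/-- Over a closed set of maps, some of which have finite robustness, the least robustness is
attained, and so is the minimum that defines it. -/
theorem exists_min_robustnessSet [Nonempty A] {S : Set (Op A B)}
    (hS : IsClosed ((coords A B).symm ⁻¹' S)) {N₀ : Op A B} (hN₀ : N₀ ∈ S) {s₀ : ℝ}
    (hs₀ : s₀ ∈ robustnessSet N₀) :
    ∃ N ∈ S, ∃ s ∈ robustnessSet N, ∀ N' ∈ S, ∀ s' ∈ robustnessSet N', s ≤ s' := by
  let V := Matrix (B × B) (A × A) ℂ
  let EB : Set V := (coords A B).symm ⁻¹' {Φ | IsEB Φ}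
  -- The map is recovered from its decomposition as `N = (1 + s) M' - s M`. Minimizing `s` over the
  -- triples `(s, M, M')`, compact once `s ≤ s₀`, needs no semicontinuity of the robustness.
  let g : ℝ × V × V → V := fun p => (1 + p.1) • p.2.2 - p.1 • p.2.1
  let T : Set (ℝ × V × V) := (Set.Icc 0 s₀ ×ˢ EB ×ˢ EB) ∩ g ⁻¹' ((coords A B).symm ⁻¹' S)
  have hT : IsCompact T :=
    (isCompact_Icc.prod (isCompact_isEB.prod isCompact_isEB)).inter_right
      (hS.preimage (by fun_prop))
  have key : ∀ N ∈ S, ∀ s ∈ robustnessSet N, s ≤ s₀ → ∃ p ∈ T, p.1 = s := by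
    intro N hN s hs hle
    obtain ⟨h0, M, M', hM, hM', h⟩ := mem_robustnessSet_iff.1 hs
    refine ⟨(s, coords A B M, coords A B M'), ⟨⟨⟨h0, hle⟩, ?_, ?_⟩, ?_⟩, rfl⟩
    · simpa [EB] using hM
    · simpa [EB] using hM'
    · have h1 : (coords A B).symm (g (s, coords A B M, coords A B M')) = N := by
        simp only [g, map_sub, map_smul, LinearEquiv.symm_apply_apply]
        rw [← h, add_sub_cancel_right]
      change (coords A B).symm _ ∈ S
      rwa [h1]
  obtain ⟨p₀, hp₀, -⟩ := key N₀ hN₀ s₀ hs₀ le_rfl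
  obtain ⟨p, hp, hmin⟩ := hT.exists_isMinOn ⟨p₀, hp₀⟩ continuous_fst.continuousOn
  refine ⟨(coords A B).symm (g p), hp.2, p.1, ?_, ?_⟩
  · refine mem_robustnessSet_iff.2 ⟨hp.1.1.1, _, _, hp.1.2.1, hp.1.2.2, ?_⟩
    simp only [g, map_sub, map_smul, sub_add_cancel]
  · intro N' hN' s' hs'
    obtain h | h := le_total s' s₀
    · obtain ⟨q, hq, rfl⟩ := key N' hN' s' hs' h
      exact hmin hq
    · exact hp.1.1.2.trans h

theorem isLeast_robustness [Nonempty A] {N : Op A B} (hN : IsChannel N) :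
    IsLeast (robustnessSet N) (robustness N) := by
  have hcl : IsClosed ((coords A B).symm ⁻¹' {N}) := by
    have h : (coords A B).symm ⁻¹' {N} = {coords A B N} := by
      ext x
      simp [LinearEquiv.symm_apply_eq]
    rw [h]
    exact isClosed_singleton
  obtain ⟨N', rfl, s, hs, hmin⟩ := exists_min_robustnessSet hcl (Set.mem_singleton N)
    (card_sub_one_mem_robustnessSet hN)
  have h : IsLeast (robustnessSet N') s := ⟨hs, hmin N' rfl⟩
  rwa [robustness, h.csInf_eq]

theorem diamondNorm_zero : diamondNorm (0 : Op A B) = 0 := by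
  simp [diamondNorm, ampl_zero, traceNorm]

theorem self_mem_channelBall {ε : ℝ} {N : Op A B} (hN : IsChannel N) : N ∈ channelBall ε N :=
  ⟨hN, by rw [sub_self, diamondNorm_zero]; exact zero_le⟩

theorem isLeast_smoothRobustness [Nonempty A] {N : Op A B} (hN : IsChannel N) {ε : ℝ}
    (hε : 0 ≤ ε) : IsLeast (robustness '' channelBall ε N) (smoothRobustness ε N) := by
  obtain ⟨N', hN', s, hs, hmin⟩ := exists_min_robustnessSet (isClosed_channelBall hε N)
    (self_mem_channelBall hN) (card_sub_one_mem_robustnessSet hN)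
  have h1 : robustness N' = s :=
    le_antisymm ((isLeast_robustness hN'.1).2 hs) (hmin N' hN' _ (isLeast_robustness hN'.1).1)
  have h : IsLeast (robustness '' channelBall ε N) s := by
    refine ⟨⟨N', hN', h1⟩, ?_⟩
    rintro _ ⟨N'', hN'', rfl⟩
    exact hmin N'' hN'' _ (isLeast_robustness hN''.1).1
  rwa [smoothRobustness, h.csInf_eq]

end Compactness

/-! ### Synthesis through the entanglement fidelity test -/

section Synthesis

theorem trace_mul_nonneg [Fintype A] {M S : Matrix A A ℂ} (hM : M.PosSemidef)
    (hS : S.PosSemidef) : 0 ≤ (M * S).trace := by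
  have h := ((isCP_sliceMap (C := Unit) hM).posSemidef
    (hS.submatrix Prod.fst)).diag_nonneg (i := ())
  rw [sliceMap_apply, Finset.sum_comm] at h
  simpa [Matrix.trace, Matrix.mul_apply] using h

theorem sliceMap_add [Fintype P] (Q R : Matrix P P ℂ) :
    sliceMap (C := C) (Q + R) = sliceMap Q + sliceMap R := by
  ext X c c'
  simp [sliceMap_apply, add_mul, Finset.sum_add_distrib]

theorem isTP_sliceMap_one [Fintype P] [DecidableEq P] [Fintype C] :
    IsTP (sliceMap (C := C) (1 : Matrix P P ℂ)) := fun X => by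
  simp only [Matrix.trace, Matrix.diag, sliceMap_apply, Matrix.one_apply, ite_mul, one_mul,
    zero_mul, Finset.sum_ite_eq', Finset.mem_univ, if_true, Fintype.sum_prod_type_right]

theorem sliceMap_attachMap [Fintype P] (Q Z : Matrix P P ℂ) (ρ : Matrix C C ℂ) :
    sliceMap Q (attachMap Z ρ) = (Q * Z).trace • ρ := by
  ext c c'
  simp only [sliceMap_apply, attachMap_apply, Matrix.smul_apply, Matrix.trace, Matrix.diag,
    Matrix.mul_apply, smul_eq_mul, Finset.sum_mul]
  rw [Finset.sum_comm]
  simp only [mul_assoc]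

variable [Fintype A] [DecidableEq A] [Fintype B] [Fintype D] [DecidableEq D]

/-- The maximally entangled state of two copies of a system. -/
def maxEntangled (D : Type*) [Fintype D] [DecidableEq D] : Matrix (D × D) (D × D) ℂ :=
  Matrix.of fun p q => if p.1 = p.2 then if q.1 = q.2 then (Fintype.card D : ℂ)⁻¹ else 0 else 0

theorem maxEntangled_apply (p q : D × D) : maxEntangled D p q =
    if p.1 = p.2 then if q.1 = q.2 then (Fintype.card D : ℂ)⁻¹ else 0 else 0 := rfl

theorem trace_maxEntangled_mul (Z : Matrix (D × D) (D × D) ℂ) :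
    (maxEntangled D * Z).trace =
      (Fintype.card D : ℂ)⁻¹ * ∑ x : D, ∑ y : D, Z (y, y) (x, x) := by
  simp [Matrix.trace, Matrix.mul_apply, maxEntangled_apply, Fintype.sum_prod_type, Finset.mul_sum,
    Finset.sum_ite_irrel]

theorem trace_maxEntangled [Nonempty D] : (maxEntangled D).trace = 1 := by
  simp [Matrix.trace, maxEntangled_apply, Fintype.sum_prod_type]

theorem maxEntangled_mul_self [Nonempty D] :
    maxEntangled D * maxEntangled D = maxEntangled D := by
  ext p q
  by_cases hp : p.1 = p.2 <;> by_cases hq : q.1 = q.2 <;>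
    simp [Matrix.mul_apply, maxEntangled_apply, Fintype.sum_prod_type, hp, hq]

theorem isHermitian_maxEntangled : (maxEntangled D).IsHermitian := by
  ext p q
  by_cases hp : p.1 = p.2 <;> by_cases hq : q.1 = q.2 <;>
    simp [Matrix.conjTranspose_apply, maxEntangled_apply, hp, hq]

theorem posSemidef_maxEntangled [Nonempty D] : (maxEntangled D).PosSemidef := by
  have h := Matrix.posSemidef_conjTranspose_mul_self (maxEntangled D)
  rwa [isHermitian_maxEntangled.eq, maxEntangled_mul_self] at h

theorem posSemidef_one_sub_maxEntangled [Nonempty D] : (1 - maxEntangled D).PosSemidef := by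
  have h := Matrix.posSemidef_conjTranspose_mul_self (1 - maxEntangled D)
  rwa [Matrix.conjTranspose_sub, Matrix.conjTranspose_one, isHermitian_maxEntangled.eq, mul_sub,
    sub_mul, sub_mul, maxEntangled_mul_self, one_mul, mul_one, one_mul, sub_self, sub_zero] at h

/-- The entanglement fidelity of a map. -/
def fidelity (Φ : Op D D) : ℂ := (maxEntangled D * ampl D Φ (maxEntangled D)).trace

theorem fidelity_id [Nonempty D] : fidelity (LinearMap.id : Op D D) = 1 := by
  rw [fidelity, ampl_id, LinearMap.id_apply, maxEntangled_mul_self, trace_maxEntangled]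

theorem fidelity_measurePrepare (M σ : Matrix D D ℂ) :
    fidelity (measurePrepare M σ) = ((Fintype.card D : ℂ)⁻¹ ^ 2) * (M * σ).trace := by
  rw [fidelity, trace_maxEntangled_mul]
  simp only [ampl_apply, measurePrepare_apply, Matrix.smul_apply, Matrix.trace, Matrix.diag,
    Matrix.mul_apply, Matrix.of_apply, maxEntangled_apply, smul_eq_mul, ite_mul, zero_mul,
    Finset.sum_ite_irrel, Finset.sum_const_zero, Finset.sum_ite_eq', Finset.sum_ite_eq,
    Finset.mem_univ, if_true, Finset.mul_sum]
  exact Finset.sum_congr rfl fun x _ => Finset.sum_congr rfl fun y _ => by ring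

theorem fidelity_sum {ι : Type*} [Fintype ι] (Φ : ι → Op D D) :
    fidelity (∑ i, Φ i) = ∑ i, fidelity (Φ i) := by
  have h : ampl D (∑ i, Φ i) = ∑ i, ampl D (Φ i) :=
    map_sum (⟨⟨ampl D, ampl_zero⟩, ampl_add⟩ : Op D D →+ Op (D × D) (D × D)) _ _
  simp [fidelity, h, LinearMap.sum_apply, Finset.mul_sum, Matrix.trace_sum]

/-- Here `d² F = ∑ Tr (Mᵢ σᵢ) ≤ ∑ Tr Mᵢ = d`, so `F ≤ 1/d`. The real witness records that the
complex trace is real. -/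
theorem IsEB.exists_fidelity_eq [Nonempty D] {Φ : Op D D} (h : IsEB Φ) :
    ∃ r : ℝ, 0 ≤ r ∧ r * Fintype.card D ≤ 1 ∧ fidelity Φ = r := by
  obtain ⟨⟨n, M, σ, hM, hσ, rfl⟩, hTP⟩ := isEB_iff.1 h
  rw [isTP_sum_measurePrepare hσ] at hTP
  have hd : (0 : ℝ) < Fintype.card D := by exact_mod_cast Fintype.card_pos
  have h0 : ∀ i, 0 ≤ (M i * σ i).trace := fun i => trace_mul_nonneg (hM i) (hσ i).1
  have h1 : ∑ i, ((M i * σ i).trace).re ≤ Fintype.card D := by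
    calc _ ≤ ∑ i, (M i).trace.re := Finset.sum_le_sum fun i _ => by
          simpa [(hσ i).2] using re_trace_mul_le (hM i) (hσ i).1
      _ = Fintype.card D := by
          rw [← Complex.re_sum, ← Matrix.trace_sum, hTP, Matrix.trace_one, Complex.natCast_re]
  refine ⟨((Fintype.card D : ℝ)⁻¹ ^ 2) * ∑ i, ((M i * σ i).trace).re, ?_, ?_, ?_⟩
  · exact mul_nonneg (by positivity) (Finset.sum_nonneg fun i _ => (Complex.le_def.1 (h0 i)).1)
  · calc _ = (Fintype.card D : ℝ)⁻¹ * ∑ i, ((M i * σ i).trace).re := by field_simp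
      _ ≤ (Fintype.card D : ℝ)⁻¹ * Fintype.card D := by gcongr
      _ = 1 := inv_mul_cancel₀ hd.ne'
  · rw [fidelity_sum]
    simp only [fidelity_measurePrepare, ← Finset.mul_sum]
    push_cast
    congr 1
    refine Finset.sum_congr rfl fun i _ => Complex.ext (by simp) ?_
    simpa using (Complex.le_def.1 (h0 i)).2.symm

/-- Regrouping of the basis of a memory next to an ancilla that holds a copy of the memory and a
system with basis labels equivalent to `A`. -/
def regroup {F : Type*} (D : Type*) (e : F ≃ A) : D × (D × F) ≃ (D × D) × A where
  toFun p := ((p.1, p.2.1), e p.2.2)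
  invFun p := (p.1.1, (p.1.2, e.symm p.2))
  left_inv p := by simp
  right_inv p := by simp

omit [Fintype A] [DecidableEq A] [Fintype D] [DecidableEq D] in
theorem reindexMap_ampl_attachMap {F : Type*} (e : F ≃ A) (Φ : Op D D)
    (Z : Matrix (D × D) (D × D) ℂ) (ρ : Matrix A A ℂ) :
    reindexMap (regroup D e).symm (ampl (D × F) Φ (reindexMap (regroup D e) (attachMap Z ρ))) =
      attachMap (ampl D Φ Z) ρ := by
  ext ⟨⟨x, y⟩, a⟩ ⟨⟨x', y'⟩, a'⟩
  have h : (Matrix.of fun z z' => reindexMap (regroup D e) (attachMap Z ρ) (z, (y, e.symm a))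
      (z', (y', e.symm a'))) = ρ a a' • Matrix.of fun z z' => Z (z, y) (z', y') := by
    ext z z'
    change Z (z, y) (z', y') * ρ (e (e.symm a)) (e (e.symm a')) = ρ a a' * Z (z, y) (z', y')
    rw [e.apply_symm_apply, e.apply_symm_apply, mul_comm]
  change Φ (Matrix.of fun z z' => reindexMap (regroup D e) (attachMap Z ρ) (z, (y, e.symm a))
      (z', (y', e.symm a'))) x x' = Φ (Matrix.of fun z z' => Z (z, y) (z', y')) x x' * ρ a a'
  rw [h, map_smul, Matrix.smul_apply, smul_eq_mul, mul_comm]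

omit [DecidableEq A] in
/-- The synthesis of a channel `N` from an ideal memory: if the fidelity test on the given memory
succeeds, then apply `N`, else apply `M`. -/
theorem exists_superchannel {D : Type} [Fintype D] [DecidableEq D] [Nonempty D] {N M : Op A B}
    (hN : IsChannel N) (hM : IsChannel M) :
    ∃ Λ : Op D D → Op A B, IsSuperchannel Λ ∧
      ∀ Φ, IsTP Φ → Λ Φ = fidelity Φ • N + (1 - fidelity Φ) • M := by
  -- The ancilla keeps half of the entangled pair and the input. The labels of the input are
  -- replaced by a `Fin` because an ancilla must lie in `Type`.
  let E := D × Fin (Fintype.card A)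
  let f : D × E ≃ (D × D) × A := regroup D (Fintype.equivFin A).symm
  let U : Op A (D × E) := reindexMap f ∘ₗ attachMap (maxEntangled D)
  let W : Op ((D × D) × A) B :=
    N ∘ₗ sliceMap (maxEntangled D) + M ∘ₗ sliceMap (1 - maxEntangled D)
  let V : Op (D × E) B := W ∘ₗ reindexMap f.symm
  have hU : IsChannel U :=
    ⟨(isCP_reindexMap _).comp (isCP_attachMap posSemidef_maxEntangled),
      (isTP_reindexMap f).comp (isTP_attachMap trace_maxEntangled)⟩
  have hW : IsTP W := fun X => by
    rw [LinearMap.add_apply, Matrix.trace_add, LinearMap.comp_apply, LinearMap.comp_apply, hN.2,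
      hM.2, ← Matrix.trace_add, ← LinearMap.add_apply, ← sliceMap_add, add_sub_cancel]
    exact isTP_sliceMap_one X
  have hV : IsChannel V :=
    ⟨((hN.1.comp (isCP_sliceMap posSemidef_maxEntangled)).add
      (hM.1.comp (isCP_sliceMap posSemidef_one_sub_maxEntangled))).comp (isCP_reindexMap _),
      hW.comp (isTP_reindexMap f.symm)⟩
  refine ⟨fun Φ => V ∘ₗ ampl E Φ ∘ₗ U, ⟨E, inferInstance, U, V, hU, hV, fun _ => rfl⟩, ?_⟩
  intro Φ hΦ
  ext1 ρ
  have h1 : reindexMap f.symm (ampl E Φ (U ρ)) = attachMap (ampl D Φ (maxEntangled D)) ρ :=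
    reindexMap_ampl_attachMap _ Φ _ ρ
  have h3 : ((1 - maxEntangled D) * ampl D Φ (maxEntangled D)).trace = 1 - fidelity Φ := by
    rw [sub_mul, one_mul, Matrix.trace_sub, hΦ.ampl, trace_maxEntangled]
    rfl
  change W (reindexMap f.symm (ampl E Φ (U ρ))) = _
  rw [h1, LinearMap.add_apply, LinearMap.comp_apply, LinearMap.comp_apply, sliceMap_attachMap,
    sliceMap_attachMap, h3, map_smul, map_smul]
  rfl

theorem exists_isFree_eq {D : Type} [Fintype D] [DecidableEq D] [Nonempty D] {N : Op A B}
    (hN : IsChannel N) (h : (Fintype.card D : ℝ) - 1 ∈ robustnessSet N) :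
    ∃ Λ : Op D D → Op A B, IsFree Λ ∧ Λ LinearMap.id = N := by
  obtain ⟨h0, M, M', hM, hM', h⟩ := mem_robustnessSet_iff.1 h
  obtain ⟨Λ, hΛ, hval⟩ := exists_superchannel (D := D) hN hM.isChannel
  refine ⟨Λ, ⟨hΛ, fun Φ hΦ => ?_⟩, ?_⟩
  · obtain ⟨r, hr0, hr1, hr⟩ := hΦ.exists_fidelity_eq
    -- Substituting `N = d M' - (d - 1) M` into `r N + (1 - r) M` leaves the weight `1 - r d` on
    -- `M`, nonnegative exactly when `r ≤ 1/d`.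
    have h1 : Λ Φ = (r * Fintype.card D) • M' + (1 - r * Fintype.card D) • M := by
      have h2 : Λ Φ = r • N + (1 - r) • M := by
        rw [hval Φ hΦ.isChannel.2, hr]
        ext ρ b b'
        simp
      have h3 : N = (Fintype.card D : ℝ) • M' - ((Fintype.card D : ℝ) - 1) • M := by
        rw [eq_sub_iff_add_eq, h, add_sub_cancel]
      rw [h2, h3]
      module
    rw [h1]
    exact hM'.combine hM (by positivity) (by linarith) (by ring)
  · rw [hval _ isChannel_id.2, fidelity_id]
    simp

end Synthesis

/-! ### From the robustness to the integer rates -/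

section Rates

variable [Fintype A] [DecidableEq A] [Nonempty A] [Fintype B] [DecidableEq B]

omit [Fintype A] [DecidableEq A] [Nonempty A] [Fintype B] [DecidableEq B] in
theorem tensorPow_idealMemory (n d : ℕ) : tensorPow n (idealMemory d) = LinearMap.id := by
  ext X b b'
  have h : ∀ a a' : Fin n → Fin d,
      ∏ i, idealMemory d (Matrix.single (a i) (a' i) 1) (b i) (b' i) =
        if a = b then if a' = b' then (1 : ℂ) else 0 else 0 := by
    intro a a'
    simp only [idealMemory, LinearMap.id_apply, Matrix.single_apply]
    rw [Finset.prod_ite_zero]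
    have hc : (∀ i ∈ Finset.univ, a i = b i ∧ a' i = b' i) ↔ a = b ∧ a' = b' := by
      simp [funext_iff, forall_and]
    simp only [hc, Finset.prod_const_one, ite_and]
  change ∑ a, ∑ a', X a a' * _ = X b b'
  simp [h]

theorem robustness_le_iff {N : Op A B} (hN : IsChannel N) {s : ℝ} :
    robustness N ≤ s ↔ s ∈ robustnessSet N :=
  ⟨robustnessSet_mono (isLeast_robustness hN).1, fun h => (isLeast_robustness hN).2 h⟩

theorem robustness_nonneg {N : Op A B} (hN : IsChannel N) : 0 ≤ robustness N :=
  (isLeast_robustness hN).1.1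

theorem exists_isFree_iff {D : Type} [Fintype D] [DecidableEq D] [Nonempty D] {N : Op A B}
    (hN : IsChannel N) : (∃ Λ : Op D D → Op A B, IsFree Λ ∧ Λ LinearMap.id = N) ↔
      robustness N ≤ (Fintype.card D : ℝ) - 1 := by
  rw [robustness_le_iff hN]
  constructor
  · rintro ⟨Λ, hΛ, rfl⟩
    exact hΛ.robustnessSet_subset _ card_sub_one_mem_robustnessSet_id
  · exact exists_isFree_eq hN

theorem mem_synthesisDims_iff {N : Op A B} (hN : IsChannel N) {ε : ℝ} (hε : 0 ≤ ε) {d : ℕ} :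
    d ∈ synthesisDims ε N ↔ 1 + ⌈smoothRobustness ε N⌉₊ ≤ d := by
  obtain ⟨⟨N₀, hN₀, h₀⟩, hmin⟩ := isLeast_smoothRobustness hN hε
  have key : 0 < d → (d ∈ synthesisDims ε N ↔ smoothRobustness ε N ≤ (d : ℝ) - 1) := by
    intro hd
    have : Nonempty (Fin d) := ⟨⟨0, hd⟩⟩
    constructor
    · rintro ⟨-, Λ, hΛ, hball⟩
      have hch : IsChannel (Λ (idealMemory d)) := hΛ.1.isChannel isChannel_id
      refine (hmin ⟨_, ⟨hch, hball⟩, rfl⟩).trans ?_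
      simpa using (exists_isFree_iff hch).1 ⟨Λ, hΛ, rfl⟩
    · intro h
      obtain ⟨Λ, hΛ, hval⟩ := (exists_isFree_iff (D := Fin d) hN₀.1).2 (by simpa [h₀] using h)
      refine ⟨hd, Λ, hΛ, ?_⟩
      rw [idealMemory, hval]
      exact hN₀.2
  obtain rfl | hd := d.eq_zero_or_pos
  · exact iff_of_false (fun h => h.1.ne rfl) (by omega)
  -- Since `d - 1` is a natural number, it bounds the robustness if and only if it bounds its
  -- ceiling.
  · rw [key hd, add_comm, ← Nat.le_sub_iff_add_le hd, Nat.ceil_le, Nat.cast_sub hd, Nat.cast_one]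

theorem isLeast_synthesisDims {N : Op A B} (hN : IsChannel N) {ε : ℝ} (hε : 0 ≤ ε) :
    IsLeast (synthesisDims ε N) (1 + ⌈smoothRobustness ε N⌉₊) :=
  ⟨(mem_synthesisDims_iff hN hε).2 le_rfl, fun _ h => (mem_synthesisDims_iff hN hε).1 h⟩

theorem isLeast_logb_synthesisDims {N : Op A B} (hN : IsChannel N) {ε : ℝ} (hε : 0 ≤ ε) :
    IsLeast ((fun d : ℕ => Real.logb 2 (d : ℝ)) '' synthesisDims ε N)
      (Real.logb 2 (1 + (⌈smoothRobustness ε N⌉₊ : ℝ))) := by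
  have h := isLeast_synthesisDims hN hε
  refine ⟨⟨_, h.1, by push_cast; rfl⟩, ?_⟩
  rintro _ ⟨d, hd, rfl⟩
  refine Real.logb_le_logb_of_le one_lt_two (by positivity) ?_
  exact_mod_cast h.2 hd

theorem isLeast_smoothLogRobustness {N : Op A B} (hN : IsChannel N) {ε : ℝ} (hε : 0 ≤ ε) :
    IsLeast (logRobustness '' channelBall ε N) (Real.logb 2 (1 + smoothRobustness ε N)) := by
  obtain ⟨⟨N₀, hN₀, h₀⟩, hmin⟩ := isLeast_smoothRobustness hN hε
  refine ⟨⟨N₀, hN₀, by rw [logRobustness, h₀]⟩, ?_⟩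
  rintro _ ⟨N', hN', rfl⟩
  have h := robustness_nonneg hN₀.1
  exact Real.logb_le_logb_of_le one_lt_two (by linarith)
    (by linarith [hmin ⟨N', hN', rfl⟩])

theorem mem_qubitCounts_iff {N : Op A B} (hN : IsChannel N) {n : ℕ} :
    n ∈ qubitCounts N ↔ ⌈Real.logb 2 ((⌈robustness N⌉₊ : ℝ) + 1)⌉₊ ≤ n := by
  have h1 : n ∈ qubitCounts N ↔ robustness N ≤ ((2 ^ n : ℕ) : ℝ) - 1 := by
    have h := exists_isFree_iff (D := Fin n → Fin 2) hN
    simp only [Fintype.card_fun, Fintype.card_fin] at h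
    rw [← h, ← tensorPow_idealMemory]
    rfl
  have h2 : robustness N ≤ ((2 ^ n : ℕ) : ℝ) - 1 ↔ ⌈robustness N⌉₊ + 1 ≤ 2 ^ n := by
    have hpos : 1 ≤ 2 ^ n := Nat.one_le_two_pow
    rw [← Nat.le_sub_iff_add_le hpos, Nat.ceil_le, Nat.cast_sub hpos, Nat.cast_one]
  rw [h1, h2, Nat.ceil_le, Real.logb_le_iff_le_rpow one_lt_two (by positivity), Real.rpow_natCast]
  norm_cast

end Rates

end QMemory
end

theorem theorem1 {A B : Type*} [Fintype A] [DecidableEq A] [Nonempty A]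
    [Fintype B] [DecidableEq B] [Nonempty B]
    (N : QMemory.Op A B) (hN : QMemory.IsChannel N) (ε : ℝ) (hε0 : 0 ≤ ε) (hε1 : ε < 1) :
    -- the minima that define the (smoothed, logarithmic) robustness are attained
    IsLeast (QMemory.robustnessSet N) (QMemory.robustness N) ∧
    IsLeast (QMemory.robustness '' QMemory.channelBall ε N) (QMemory.smoothRobustness ε N) ∧
    IsLeast (QMemory.logRobustness '' QMemory.channelBall ε N)
      (QMemory.smoothLogRobustness ε N) ∧
    -- the least dimension of an ideal memory
    IsLeast (QMemory.synthesisDims ε N) (1 + ⌈QMemory.smoothRobustness ε N⌉₊) ∧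
    -- the logarithmic form, exactly and up to one qubit
    IsLeast ((fun d : ℕ => Real.logb 2 (d : ℝ)) '' QMemory.synthesisDims ε N)
      (QMemory.dilutionRate ε N) ∧
    QMemory.dilutionRate ε N = Real.logb 2 (1 + (⌈QMemory.smoothRobustness ε N⌉₊ : ℝ)) ∧
    QMemory.smoothLogRobustness ε N ≤ QMemory.dilutionRate ε N ∧
    QMemory.dilutionRate ε N ≤ QMemory.smoothLogRobustness ε N + 1 ∧
    -- the least number of ideal qubit memories for exact synthesis
    IsLeast (QMemory.qubitCounts N)
      ⌈Real.logb 2 ((⌈QMemory.robustness N⌉₊ : ℝ) + 1)⌉₊ := by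
  have hR := QMemory.isLeast_smoothRobustness hN hε0
  have hL := QMemory.isLeast_smoothLogRobustness hN hε0
  have hD := QMemory.isLeast_logb_synthesisDims hN hε0
  have hLval : QMemory.smoothLogRobustness ε N =
      Real.logb 2 (1 + QMemory.smoothRobustness ε N) := hL.csInf_eq
  have hDval : QMemory.dilutionRate ε N =
      Real.logb 2 (1 + (⌈QMemory.smoothRobustness ε N⌉₊ : ℝ)) := hD.csInf_eq
  have h0 : 0 ≤ QMemory.smoothRobustness ε N := by
    obtain ⟨N', hN', h⟩ := hR.1
    exact h ▸ QMemory.robustness_nonneg hN'.1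
  refine ⟨QMemory.isLeast_robustness hN, hR, hLval ▸ hL, QMemory.isLeast_synthesisDims hN hε0,
    hDval ▸ hD, hDval, ?_, ?_, (QMemory.mem_qubitCounts_iff hN).2 le_rfl,
    fun _ h => (QMemory.mem_qubitCounts_iff hN).1 h⟩
  · rw [hLval, hDval]
    exact Real.logb_le_logb_of_le one_lt_two (by linarith) (by
      have h := Nat.le_ceil (QMemory.smoothRobustness ε N)
      linarith)
  -- One bit is a factor of two: `1 + ⌈R⌉ < 2 + R ≤ 2 (1 + R)`.
  · have h1 : Real.logb 2 (1 + QMemory.smoothRobustness ε N) + 1 =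
        Real.logb 2 ((1 + QMemory.smoothRobustness ε N) * 2) := by
      rw [Real.logb_mul (by linarith) two_ne_zero, Real.logb_self_eq_one one_lt_two]
    rw [hLval, hDval, h1]
    exact Real.logb_le_logb_of_le one_lt_two (by positivity)
      (by linarith [Nat.ceil_lt_add_one h0])
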